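/- Let $q=2^m$ with $m\ge 3$, let $\mathbb{F}_q$ be the field with $q$ elements, and let $n=q+4$. Then there is a $q$-ary Singleton-optimal locally repairable code (LRC) of length $n$ with minimum distance $d=6$ and locality $r=3$ that has disjoint repair groups. That is, there are an integer $k$ and a linear code $C\subseteq\mathbb{F}_q^{\,n}$ such that (a) $C$ has dimension $k$ and minimum Hamming distance $6$; (b) the Singleton-type bound $d\le n-k-\lceil k/r\rceil+2$ holds with equality: $6=n-k-\lceil k/3\rceil+2$; (c) $C$ has locality $3$ with disjoint repair groups: the set of coordinates $\{1,\dots,n\}$ is a disjoint union of $n/4$ sets $R$ of size $4$ such that, for every such $R$ and every $i\in R$, there are coefficients $a_j\in\mathbb{F}_q$ with $c_i=\sum_{j\in R\setminus\{i\}}a_jc_j$ for all codewords $c\in C$. -/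

import Mathlib

/-- A linear code of length `n` over `F`: a subspace of `F^n`. -/
abbrev LinearCode (F : Type*) [Field F] (n : ℕ) := Submodule F (Fin n → F)

namespace LinearCode

variable {F : Type*} [Field F] {n : ℕ}

/-- `d` is the minimum distance of `C`: the least Hamming distance between two distinct
codewords (so in particular `C` has two distinct codewords). -/
def HasMinDist [DecidableEq F] (C : LinearCode F n) (d : ℕ) : Prop :=
  IsLeast {w : ℕ | ∃ x ∈ C, ∃ y ∈ C, x ≠ y ∧ hammingDist x y = w} d

/-- `R` is a repair group, for locality `r`, of the `i`-th symbol of `C`: `i ∈ R`, `|R| ≤ r + 1`,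
and the `i`-th symbol is a fixed linear combination of the symbols in `R \ {i}`. -/
def IsRepairGroup (C : LinearCode F n) (r : ℕ) (i : Fin n) (R : Finset (Fin n)) : Prop :=
  i ∈ R ∧ R.card ≤ r + 1 ∧ ∃ a : Fin n → F, ∀ c ∈ C, c i = ∑ j ∈ R.erase i, a j * c j

/-- `C` has locality `r`: every symbol has a repair group. -/
def HasLocality (C : LinearCode F n) (r : ℕ) : Prop :=
  ∀ i : Fin n, ∃ R : Finset (Fin n), C.IsRepairGroup r i R

/-- The set of coordinates is partitioned into sets of size exactly `r + 1`, each of which is a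
repair group of every symbol in it. -/
def HasDisjointRepairGroups (C : LinearCode F n) (r : ℕ) : Prop :=
  ∃ P : Finpartition (Finset.univ : Finset (Fin n)),
    ∀ R ∈ P.parts, R.card = r + 1 ∧ ∀ i ∈ R, C.IsRepairGroup r i R

/-- `C` is an `(n, k, d; r)`-LRC: an `[n, k, d]` linear code with locality `r`. -/
structure IsLRC [DecidableEq F] (C : LinearCode F n) (k d r : ℕ) : Prop where
  dim : Module.finrank F C = k
  minDist : C.HasMinDist d
  locality : C.HasLocality r

/-- `C` is a Singleton-optimal `(n, k, d; r)`-LRC: it attains the Singleton-type bound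
`d ≤ n - k - ⌈k / r⌉ + 2` with equality. -/
structure IsSingletonOptimalLRC [DecidableEq F] (C : LinearCode F n) (k d r : ℕ) : Prop
    extends IsLRC C k d r where
  optimal : (d : ℤ) = (n : ℤ) - (k : ℤ) - ⌈(k : ℚ) / (r : ℚ)⌉ + 2

end LinearCode

/-!
The coordinates are attached to points `p P` of the projective plane over `F`, arranged in groups of
four, and the codewords are the words `(p P ⬝ᵥ w (g P))_P`, where `w` runs over the families of linear
forms on `F ^ 3`, one form for each group `g P`, with sum zero. Suppose that each group is a
quadrangle, that is, no three of its points are collinear, and that no side of a quadrangle passes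
through a point of another one (`NoGroupSecantMeets`). A fourth point of a quadrangle is then a
combination of the other three, so that the groups are repair groups. A nonzero form vanishes at two
points at most of a group, so a word with three nonzero forms has weight at least six; a word with
exactly two nonzero forms has the same form up to sign in two groups, and this form vanishes at two
points at most of their union, so the weight is again at least `8 - 2`
(`six_le_hammingNorm_groupEval`). With `t` groups the length is `4 * t` and the dimension is
`3 * (t - 1)`, which makes a code of minimum distance six Singleton-optimal.

It remains to find `q / 4 + 1` such quadrangles. Let `V` be an additive subgroup of `F` of order four.
The points of the parabola `Y = X ^ 2` over the cosets of `V` give `q / 4` quadrangles, and the points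
of `Y = X ^ 2 + e` over `V` give one more. Their sides have slopes in `V \ {0}`, and a side of slope
`s` of a quadrangle on one parabola meets the other parabola exactly if `y ^ 2 + s * y = e` has a
solution. For `e = z ^ 2` there is none if `z / s` has absolute trace `1`, because `x ^ 2` and `x` have
the same trace. Such a `z` exists for `V = {0, 1, b, 1 + b}` as soon as `b` is not in the field with
four elements: the inverses of `1`, `b` and `1 + b` are then linearly independent over `ZMod 2`, and
the trace form is nondegenerate (`exists_trace_mul_inv`). This needs `q > 4` only.
-/

open Matrix

/-! ### The code of a system of quadrangles -/

namespace LinearCode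

section

variable {F ι : Type*} [Field F] {n : ℕ}

/-- The linear map sending a family `w` of linear forms on `F ^ 3`, one for each group, to the word
whose symbol at `P` is the value at the vector `p P` of the form belonging to the group `g P`. -/
def groupEval (p : Fin n → Fin 3 → F) (g : Fin n → ι) : (ι → Fin 3 → F) →ₗ[F] (Fin n → F) where
  toFun w P := p P ⬝ᵥ w (g P)
  map_add' w w' := by ext P; simp
  map_smul' a w := by ext P; simp

theorem groupEval_apply (p : Fin n → Fin 3 → F) (g : Fin n → ι) (w : ι → Fin 3 → F)
    (P : Fin n) : groupEval p g w P = p P ⬝ᵥ w (g P) := rfl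

/-- The families of linear forms with sum zero. -/
def zeroSum (F ι : Type*) [Field F] [Fintype ι] : Submodule F (ι → Fin 3 → F) :=
  LinearMap.ker (∑ i : ι, LinearMap.proj i)

theorem mem_zeroSum [Fintype ι] {w : ι → Fin 3 → F} : w ∈ zeroSum F ι ↔ ∑ i, w i = 0 := by
  simp [zeroSum, LinearMap.sum_apply]

theorem finrank_zeroSum [Fintype ι] [DecidableEq ι] [Nonempty ι] :
    Module.finrank F (zeroSum F ι) = 3 * (Fintype.card ι - 1) := by
  have hs : LinearMap.range (∑ i : ι, LinearMap.proj i : (ι → Fin 3 → F) →ₗ[F] _) = ⊤ := by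
    refine LinearMap.range_eq_top.2 fun v => ?_
    obtain ⟨i⟩ := ‹Nonempty ι›
    refine ⟨Pi.single i v, ?_⟩
    simp [LinearMap.sum_apply]
  have := LinearMap.finrank_range_add_finrank_ker
    (∑ i : ι, LinearMap.proj i : (ι → Fin 3 → F) →ₗ[F] _)
  have hd : Module.finrank F (ι → Fin 3 → F) = Fintype.card ι * 3 := by
    simp [Module.finrank_pi_fintype]
  rw [hs, finrank_top, hd, Module.finrank_fin_fun] at this
  unfold zeroSum
  omega

/-- The code consisting of the words `groupEval p g w` with `w` of sum zero. -/
def groupCode [Fintype ι] (p : Fin n → Fin 3 → F) (g : Fin n → ι) : LinearCode F n :=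
  (zeroSum F ι).map (groupEval p g)

/-- Three distinct points, two of which are in the same group, are never collinear: the points
`p P` of the projective plane then form quadrangles, if the groups have size four, and no line
joining two points of one quadrangle passes through a point of another. Noncollinearity is
expressed by the absence of a nonzero linear form vanishing at all three points. -/
def NoGroupSecantMeets (p : Fin n → Fin 3 → F) (g : Fin n → ι) : Prop :=
  ∀ P Q R : Fin n, P ≠ Q → P ≠ R → Q ≠ R → g P = g Q →
    ∀ w : Fin 3 → F, p P ⬝ᵥ w = 0 → p Q ⬝ᵥ w = 0 → p R ⬝ᵥ w = 0 → w = 0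

variable {p : Fin n → Fin 3 → F} {g : Fin n → ι}

/-- The coordinates of the group `i`. -/
abbrev fiber [DecidableEq ι] (g : Fin n → ι) (i : ι) : Finset (Fin n) :=
  Finset.univ.filter fun P => g P = i

variable [DecidableEq ι]

/-- A nonzero form vanishes at two points at most of each group. -/
theorem two_le_card_fiber_ne_zero [DecidableEq F] (hp : NoGroupSecantMeets p g)
    (hg : ∀ i, (fiber g i).card = 4)
    {w : Fin 3 → F} (hw : w ≠ 0) (i : ι) :
    2 ≤ ((fiber g i).filter fun P => p P ⬝ᵥ w ≠ 0).card := by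
  have h1 := Finset.card_filter_add_card_filter_not (s := fiber g i) (fun P => p P ⬝ᵥ w = 0)
  rw [hg] at h1
  by_contra! h
  simp only [ne_eq] at h
  obtain ⟨P, Q, R, hP, hQ, hR, h2, h3, h4⟩ := Finset.two_lt_card_iff.1
    (show 2 < ((fiber g i).filter fun P => p P ⬝ᵥ w = 0).card by omega)
  simp only [Finset.mem_filter, Finset.mem_univ, true_and] at hP hQ hR
  exact hw (hp P Q R h2 h3 h4 (hP.1.trans hQ.1.symm) w hP.2 hQ.2 hR.2)

/-- A nonzero form vanishes at two points at most of the union of two groups. -/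
theorem six_le_card_two_fibers_ne_zero [DecidableEq F] (hp : NoGroupSecantMeets p g)
    (hg : ∀ i, (fiber g i).card = 4)
    {w : Fin 3 → F} (hw : w ≠ 0) {i j : ι} (hij : i ≠ j) :
    6 ≤ ((fiber g i ∪ fiber g j).filter fun P => p P ⬝ᵥ w ≠ 0).card := by
  have h0 : (fiber g i ∪ fiber g j).card = 8 := by
    rw [Finset.card_union_of_disjoint, hg, hg]
    exact Finset.disjoint_filter.2 fun P _ h h' => hij (h.symm.trans h')
  have h1 := Finset.card_filter_add_card_filter_not (s := fiber g i ∪ fiber g j)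
    (fun P => p P ⬝ᵥ w = 0)
  rw [h0] at h1
  by_contra! h
  simp only [ne_eq] at h
  obtain ⟨P, Q, R, hP, hQ, hR, h2, h3, h4⟩ := Finset.two_lt_card_iff.1
    (show 2 < ((fiber g i ∪ fiber g j).filter fun P => p P ⬝ᵥ w = 0).card by omega)
  simp only [Finset.mem_filter, Finset.mem_union, Finset.mem_univ, true_and] at hP hQ hR
  -- Two of the three points are in the same group.
  have : g P = g Q ∨ g P = g R ∨ g Q = g R := by grind
  rcases this with h5 | h5 | h5
  · exact hw (hp P Q R h2 h3 h4 h5 w hP.2 hQ.2 hR.2)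
  · exact hw (hp P R Q h3 h2 h4.symm h5 w hP.2 hR.2 hQ.2)
  · exact hw (hp Q R P h4 h2.symm h3.symm h5 w hQ.2 hR.2 hP.2)

variable [Fintype ι]

theorem six_le_hammingNorm_groupEval [DecidableEq F] (hp : NoGroupSecantMeets p g)
    (hg : ∀ i, (fiber g i).card = 4) {w : ι → Fin 3 → F} (hw : w ∈ zeroSum F ι) (hw0 : w ≠ 0) :
    6 ≤ hammingNorm (groupEval p g w) := by
  classical
  rw [mem_zeroSum] at hw
  obtain ⟨i, hi⟩ := Function.ne_iff.1 hw0
  have hi : w i ≠ 0 := hi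
  obtain ⟨j, hji, hj⟩ : ∃ j, j ≠ i ∧ w j ≠ 0 := by
    by_contra! h
    exact hi (by rwa [Fintype.sum_eq_single i h] at hw)
  by_cases h3 : ∃ k, k ≠ i ∧ k ≠ j ∧ w k ≠ 0
  · -- Each of three groups contributes at least two nonzero symbols.
    obtain ⟨k, hki, hkj, hk⟩ := h3
    have hS : ∑ l ∈ ({i, j, k} : Finset ι), 2 ≤ ∑ l ∈ ({i, j, k} : Finset ι),
        ((fiber g l).filter fun P => p P ⬝ᵥ w l ≠ 0).card := by
      refine Finset.sum_le_sum fun l hl => two_le_card_fiber_ne_zero hp hg ?_ l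
      simp only [Finset.mem_insert, Finset.mem_singleton] at hl
      rcases hl with rfl | rfl | rfl <;> assumption
    have hc : ({i, j, k} : Finset ι).card = 3 :=
      Finset.card_eq_three.2 ⟨i, j, k, hji.symm, hki.symm, hkj.symm, rfl⟩
    rw [← Finset.card_biUnion, Finset.sum_const, hc] at hS
    · refine hS.trans (Finset.card_le_card fun P hP => ?_)
      simp only [Finset.mem_biUnion, Finset.mem_filter, Finset.mem_univ, true_and] at hP ⊢
      obtain ⟨l, -, hl, h⟩ := hP
      simpa only [groupEval_apply, hl] using h
    · intro l _ l' _ hll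
      refine Finset.disjoint_left.2 fun P h h' => hll ?_
      simp only [Finset.mem_filter, Finset.mem_univ, true_and] at h h'
      exact h.1.symm.trans h'.1
  · push Not at h3
    -- Only two groups have a nonzero form, and their forms vanish at the same points.
    have hij : w i = -w j := by
      rw [← Finset.sum_subset (Finset.subset_univ {i, j}) (fun k _ hk => ?_),
        Finset.sum_pair hji.symm] at hw
      · exact eq_neg_of_add_eq_zero_left hw
      · simp only [Finset.mem_insert, Finset.mem_singleton, not_or] at hk
        exact h3 k hk.1 hk.2
    refine (six_le_card_two_fibers_ne_zero hp hg hi hji.symm).trans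
      (Finset.card_le_card fun P hP => ?_)
    simp only [Finset.mem_union, Finset.mem_filter, Finset.mem_univ, true_and] at hP
    refine Finset.mem_filter.2 ⟨Finset.mem_univ _, ?_⟩
    rw [groupEval_apply]
    rcases hP with ⟨h | h, h'⟩
    · rwa [h]
    · rw [h]; rwa [hij, dotProduct_neg, neg_ne_zero] at h'

theorem eq_zero_of_groupEval_eq_zero (hp : NoGroupSecantMeets p g)
    (hg : ∀ i, (fiber g i).card = 4) {w : ι → Fin 3 → F} (hw : w ∈ zeroSum F ι)
    (h : groupEval p g w = 0) : w = 0 := by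
  classical
  by_contra h0
  have := six_le_hammingNorm_groupEval hp hg hw h0
  simp [h] at this

theorem finrank_groupCode [Nonempty ι] (hp : NoGroupSecantMeets p g)
    (hg : ∀ i, (fiber g i).card = 4) :
    Module.finrank F (groupCode p g) = 3 * (Fintype.card ι - 1) := by
  rw [← finrank_zeroSum (F := F) (ι := ι), groupCode]
  rw [← LinearMap.range_domRestrict]
  refine LinearMap.finrank_range_of_inj ?_
  rw [← LinearMap.ker_eq_bot, LinearMap.ker_eq_bot']
  exact fun w hw => Subtype.ext (eq_zero_of_groupEval_eq_zero hp hg w.2 hw)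

/-- A word of weight six comes from the line through points of two different groups. -/
theorem exists_hammingNorm_groupEval_le [DecidableEq F] [Nontrivial ι]
    (hg : ∀ i, (fiber g i).card = 4) :
    ∃ w ∈ zeroSum F ι, w ≠ 0 ∧ hammingNorm (groupEval p g w) ≤ 6 := by
  classical
  obtain ⟨i, j, hij⟩ := exists_pair_ne ι
  obtain ⟨P, hP⟩ := Finset.card_pos.1 (show 0 < (fiber g i).card by simp [hg])
  obtain ⟨Q, hQ⟩ := Finset.card_pos.1 (show 0 < (fiber g j).card by simp [hg])
  simp only [Finset.mem_filter, Finset.mem_univ, true_and] at hP hQ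
  obtain ⟨v, hv, hv0⟩ := (Submodule.ne_bot_iff _).1 (LinearMap.ker_ne_bot_of_finrank_lt
    (f := Matrix.mulVecLin (Matrix.of ![p P, p Q])) (by simp))
  have hv := LinearMap.mem_ker.1 hv
  have hvP : p P ⬝ᵥ v = 0 := congrFun hv 0
  have hvQ : p Q ⬝ᵥ v = 0 := congrFun hv 1
  let w : ι → Fin 3 → F := Pi.single i v - Pi.single j v
  have hwi : w i = v := by simp [w, hij]
  have hwj : w j = -v := by simp [w, hij.symm]
  have hwk : ∀ k, k ≠ i → k ≠ j → w k = 0 := fun k hi hj => by simp [w, hi, hj]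
  refine ⟨w, mem_zeroSum.2 (by simp [w]), fun h => hv0 (by simpa [h] using hwi.symm), ?_⟩
  have hPQ : P ≠ Q := by rintro rfl; exact hij (hP.symm.trans hQ)
  have hsub : (Finset.univ.filter fun R => groupEval p g w R ≠ 0) ⊆
      (fiber g i ∪ fiber g j) \ {P, Q} := by
    intro R hR
    have hR : p R ⬝ᵥ w (g R) ≠ 0 := (Finset.mem_filter.1 hR).2
    simp only [Finset.mem_filter, Finset.mem_univ, true_and, Finset.mem_sdiff,
      Finset.mem_union, Finset.mem_insert, Finset.mem_singleton]
    refine ⟨?_, ?_⟩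
    · by_contra! h
      exact hR (by rw [hwk _ h.1 h.2, dotProduct_zero])
    · rintro (rfl | rfl)
      · exact hR (by rw [hP, hwi, hvP])
      · exact hR (by rw [hQ, hwj, dotProduct_neg, hvQ, neg_zero])
  refine (Finset.card_le_card hsub).trans ?_
  rw [Finset.card_sdiff_of_subset, Finset.card_pair hPQ]
  · have := Finset.card_union_le (fiber g i) (fiber g j)
    rw [hg, hg] at this
    omega
  · intro R hR
    simp only [Finset.mem_insert, Finset.mem_singleton] at hR
    rcases hR with rfl | rfl <;> simp [hP, hQ]

theorem hasMinDist_groupCode [DecidableEq F] [Nontrivial ι] (hp : NoGroupSecantMeets p g)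
    (hg : ∀ i, (fiber g i).card = 4) : (groupCode p g).HasMinDist 6 := by
  constructor
  · obtain ⟨w, hw, hw0, h⟩ := exists_hammingNorm_groupEval_le (p := p) hg
    refine ⟨groupEval p g w, Submodule.mem_map_of_mem hw, 0, zero_mem _,
      fun h => hw0 (eq_zero_of_groupEval_eq_zero hp hg hw h), ?_⟩
    rw [hammingDist_zero_right]
    exact h.antisymm (six_le_hammingNorm_groupEval hp hg hw hw0)
  · rintro d ⟨x, hx, y, hy, hxy, rfl⟩
    obtain ⟨w, hw, h⟩ := Submodule.mem_map.1 (sub_mem hx hy)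
    rw [hammingDist_comm, hammingDist_eq_hammingNorm, neg_add_eq_sub, ← h]
    refine six_le_hammingNorm_groupEval hp hg hw ?_
    rintro rfl
    exact hxy (sub_eq_zero.1 (by simpa using h.symm))

/-- Three points of a group of four are a basis of `F ^ 3`, and the fourth point is a linear
combination of them. -/
theorem isRepairGroup_fiber (hp : NoGroupSecantMeets p g)
    (hg : ∀ i, (fiber g i).card = 4) (P : Fin n) :
    (groupCode p g).IsRepairGroup 3 P (fiber g (g P)) := by
  classical
  refine ⟨by simp, (hg _).le, ?_⟩
  set R := (fiber g (g P)).erase P with hR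
  have hRc : R.card = 3 := by rw [hR, Finset.card_erase_of_mem (by simp), hg]
  obtain ⟨A, B, D, hA, hB, hD, hAB, hAD, hBD⟩ := Finset.two_lt_card_iff.1
    (show 2 < R.card by omega)
  -- A form on `F ^ 3` is determined by its values at the points of `R`.
  let ψ : (Fin 3 → F) →ₗ[F] (Fin n → F) :=
    { toFun := fun w Q => if Q ∈ R then p Q ⬝ᵥ w else 0
      map_add' := fun w w' => by ext Q; simp only [dotProduct_add, Pi.add_apply]; split_ifs <;> simp
      map_smul' := fun a w => by ext Q; simp }
  have hψ : ∀ w Q, ψ w Q = if Q ∈ R then p Q ⬝ᵥ w else 0 := fun _ _ => rfl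
  obtain ⟨φ, hφ⟩ := LinearMap.exists_leftInverse_of_injective ψ (by
    refine LinearMap.ker_eq_bot'.2 fun w hw => ?_
    have h0 : ∀ Q ∈ R, p Q ⬝ᵥ w = 0 := fun Q hQ => by
      simpa [hψ, hQ] using congrFun hw Q
    refine hp A B D hAB hAD hBD ?_ w (h0 A hA) (h0 B hB) (h0 D hD)
    simp only [hR, Finset.mem_erase, Finset.mem_filter, Finset.mem_univ, true_and] at hA hB
    exact hA.2.trans hB.2.symm)
  refine ⟨fun Q => p P ⬝ᵥ φ (Pi.single Q 1), ?_⟩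
  rintro c hc
  obtain ⟨w, -, rfl⟩ := Submodule.mem_map.1 hc
  have h1 : φ (ψ (w (g P))) = w (g P) := LinearMap.congr_fun hφ _
  rw [groupEval_apply, ← h1, LinearMap.pi_apply_eq_sum_univ φ, dotProduct_sum,
    ← Finset.sum_subset (Finset.subset_univ R)]
  · refine Finset.sum_congr rfl fun Q hQ => ?_
    have hQ' : g Q = g P := by simpa using (Finset.mem_erase.1 hQ).2
    rw [hψ, if_pos hQ, dotProduct_smul, groupEval_apply, hQ', smul_eq_mul, mul_comm]
    congr 3
    ext k; simp [Pi.single_apply, eq_comm]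
  · intro Q _ hQ
    simp [hψ, hQ]

theorem hasDisjointRepairGroups_groupCode (hp : NoGroupSecantMeets p g)
    (hg : ∀ i, (fiber g i).card = 4) : (groupCode p g).HasDisjointRepairGroups 3 := by
  refine ⟨Finpartition.ofSetoid (Setoid.ker g), fun R hR => ?_⟩
  obtain ⟨P, rfl⟩ : ∃ P, fiber g (g P) = R := by
    obtain ⟨P, hP⟩ := Finpartition.nonempty_of_mem_parts _ hR
    refine ⟨P, ?_⟩
    rw [← Finpartition.part_eq_of_mem _ hR hP]
    ext Q
    rw [Finpartition.mem_part_ofSetoid_iff_rel, Setoid.ker_def]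
    simp [eq_comm]
  refine ⟨hg _, fun Q hQ => ?_⟩
  have : g Q = g P := by simpa using hQ
  rw [← this]
  exact isRepairGroup_fiber hp hg Q

theorem isSingletonOptimalLRC_groupCode [DecidableEq F] [Nontrivial ι]
    (hp : NoGroupSecantMeets p g) (hg : ∀ i, (fiber g i).card = 4) :
    (groupCode p g).IsSingletonOptimalLRC (3 * (Fintype.card ι - 1)) 6 3 where
  dim := finrank_groupCode hp hg
  minDist := hasMinDist_groupCode hp hg
  locality P := ⟨_, isRepairGroup_fiber hp hg P⟩
  optimal := by
    -- Counting the coordinates by groups gives the length.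
    have hn : n = 4 * Fintype.card ι := by
      have := Finset.card_eq_sum_card_fiberwise (f := g) (s := Finset.univ) (t := Finset.univ)
        (by simp)
      rw [Finset.sum_congr rfl fun i _ => hg i] at this
      simpa [mul_comm] using this
    obtain ⟨t, ht⟩ : ∃ t, Fintype.card ι = t + 1 :=
      Nat.exists_eq_add_one.2 Fintype.card_pos
    have hc : ((3 * t : ℕ) : ℚ) / (3 : ℕ) = (t : ℤ) := by push_cast; field_simp
    rw [hn, ht, Nat.add_sub_cancel, hc, Int.ceil_intCast]
    push_cast
    ring

end

end LinearCode

/-! ### Trace conditions in characteristic two -/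

section

variable {F : Type*} [Field F] [Fintype F]

/-- The last hypothesis says that `a / b` is not a primitive cube root of unity. It makes the
inverses of `a`, `b` and `a + b` linearly independent, and any values may then be prescribed for
`trace (z * ·)` at them. -/
theorem exists_trace_mul_inv [CharP F 2] [Algebra (ZMod 2) F]
    {a b : F} (ha : a ≠ 0) (hb : b ≠ 0) (hab : a + b ≠ 0) (h : a ^ 2 + a * b + b ^ 2 ≠ 0) :
    ∃ z : F, ∀ s ∈ ({a, b, a + b} : Set F), Algebra.trace (ZMod 2) F (z * s⁻¹) = 1 := by
  have h2 : (2 : F) = 0 := CharTwo.two_eq_zero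
  let v : Fin 3 → F := ![a⁻¹, b⁻¹, (a + b)⁻¹]
  have hv : LinearIndependent (ZMod 2) v := by
    rw [Fintype.linearIndependent_iff]
    intro g hg
    have hz : ∀ x : ZMod 2, x = 0 ∨ x = 1 := by decide
    simp only [Fin.sum_univ_three, v, Matrix.cons_val] at hg
    have e1 : a⁻¹ + b⁻¹ ≠ 0 := by
      intro h0; apply hab; field_simp at h0; linear_combination h0
    have e2 : a⁻¹ + (a + b)⁻¹ ≠ 0 := by
      intro h0; apply hb; field_simp at h0; linear_combination h0 - a * h2
    have e3 : b⁻¹ + (a + b)⁻¹ ≠ 0 := by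
      intro h0; apply ha; field_simp at h0; linear_combination h0 - b * h2
    have e4 : a⁻¹ + b⁻¹ + (a + b)⁻¹ ≠ 0 := by
      intro h0; apply h; field_simp at h0; linear_combination h0 - a * b * h2
    -- The nonempty subsums of the three inverses are not zero.
    rcases hz (g 0) with h0 | h0 <;> rcases hz (g 1) with h1 | h1 <;>
      rcases hz (g 2) with h3 | h3 <;> simp [h0, h1, h3, ha, hb, hab, e1, e2, e3, e4] at hg
    intro i
    fin_cases i <;> assumption
  obtain ⟨g, hg⟩ := LinearMap.exists_leftInverse_of_injective
    (Fintype.linearCombination (ZMod 2) v)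
    (LinearMap.ker_eq_bot.2 (hv.fintypeLinearCombination_injective))
  -- `φ` is a linear functional with value `1` at the three inverses.
  let φ : F →ₗ[ZMod 2] ZMod 2 := (∑ i : Fin 3, LinearMap.proj i) ∘ₗ g
  have hφ : ∀ i, φ (v i) = 1 := by
    intro i
    have := LinearMap.congr_fun hg (Pi.single i 1)
    simp only [LinearMap.comp_apply, Fintype.linearCombination_apply_single, one_smul,
      LinearMap.id_apply] at this
    simp [φ, this]
  -- The trace form represents `φ` as `trace (z * ·)`.
  let e := (Algebra.traceForm (ZMod 2) F).toDual (traceForm_nondegenerate (ZMod 2) F)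
  have he : ∀ x, Algebra.trace (ZMod 2) F (e.symm φ * x) = φ x := by
    intro x
    have := LinearMap.congr_fun (e.apply_symm_apply φ) x
    rwa [LinearMap.BilinForm.toDual_def, Algebra.traceForm_apply] at this
  refine ⟨e.symm φ, ?_⟩
  rintro s (rfl | rfl | rfl)
  · rw [he]; exact hφ 0
  · rw [he]; exact hφ 1
  · rw [he]; exact hφ 2

theorem trace_sq_zmod_two [CharP F 2] [Algebra (ZMod 2) F] (x : F) :
    Algebra.trace (ZMod 2) F (x ^ 2) = Algebra.trace (ZMod 2) F x := by
  have := Algebra.trace_eq_of_algEquiv (FiniteField.frobeniusAlgEquivOfAlgebraic (ZMod 2) F) x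
  simpa using this

/-- After division by `s ^ 2`, an equality would give `trace (z / s) = trace (w / s) + trace (w / s)`,
which is zero. -/
theorem sq_add_mul_ne_sq [CharP F 2] [Algebra (ZMod 2) F] {z s : F} (hs : s ≠ 0)
    (h : Algebra.trace (ZMod 2) F (z * s⁻¹) = 1) (w : F) :
    w ^ 2 + s * w ≠ z ^ 2 := by
  intro hw
  have hz : (z * s⁻¹) ^ 2 = (w * s⁻¹) ^ 2 + w * s⁻¹ := by
    field_simp
    rw [← hw]; ring
  have ht := congrArg (Algebra.trace (ZMod 2) F) hz
  rw [map_add, trace_sq_zmod_two, trace_sq_zmod_two, h, CharTwo.add_self_eq_zero] at ht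
  exact one_ne_zero ht

theorem exists_pow_four_ne (h : 4 < Fintype.card F) : ∃ b : F, b ^ 4 ≠ b := by
  by_contra! hb
  have h0 : (Polynomial.X ^ 4 - Polynomial.X : Polynomial F) = 0 := by
    refine Polynomial.eq_zero_of_natDegree_lt_card_of_eval_eq_zero _ (f := id)
      Function.injective_id (fun x => by simp [hb x]) ?_
    rwa [FiniteField.X_pow_card_sub_X_natDegree_eq F (by norm_num)]
  exact FiniteField.X_pow_card_sub_X_ne_zero F (by norm_num) h0

end

section

variable {F : Type*} [Field F]

/-- The subgroup `{0, 1, b, 1 + b}` of a field of characteristic two. -/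
def fourGroup [CharP F 2] (b : F) : AddSubgroup F where
  carrier := {0, 1, b, 1 + b}
  zero_mem' := by simp
  add_mem' := by
    have h2 : (2 : F) = 0 := CharTwo.two_eq_zero
    have h1 : (1 : F) + 1 = 0 := CharTwo.add_self_eq_zero 1
    have hb : b + b = 0 := CharTwo.add_self_eq_zero b
    simp only [Set.mem_insert_iff, Set.mem_singleton_iff]
    grind
  neg_mem' := by
    intro x hx
    rwa [CharTwo.neg_eq]

theorem mem_fourGroup [CharP F 2] {b x : F} :
    x ∈ fourGroup b ↔ x = 0 ∨ x = 1 ∨ x = b ∨ x = 1 + b := Iff.rfl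

theorem card_fourGroup [CharP F 2] {b : F} (h0 : b ≠ 0) (h1 : b ≠ 1) :
    Nat.card (fourGroup b) = 4 := by
  classical
  have h : ((fourGroup b : AddSubgroup F) : Set F) = (({0, 1, b, 1 + b} : Finset F) : Set F) := by
    ext x; simp [mem_fourGroup]
  have h2 : (1 : F) + b ≠ 0 := fun h => h1 (CharTwo.add_eq_zero.1 h).symm
  change Nat.card ((fourGroup b : AddSubgroup F) : Set F) = 4
  rw [Nat.card_coe_set_eq, h, Set.ncard_coe_finset]
  rw [Finset.card_insert_of_notMem, Finset.card_insert_of_notMem, Finset.card_insert_of_notMem,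
    Finset.card_singleton]
  · simp
  · simp [h0, h1.symm]
  · simp [h0.symm, h2.symm]

/-- There is a subgroup `V` of order four and an element `e` such that none of the maps
`y ↦ y ^ 2 + s * y`, for `s` a nonzero element of `V`, takes the value `e`. -/
theorem exists_addSubgroup_card_four_sq_add_mul_ne [Fintype F] [CharP F 2]
    (hF : 4 < Fintype.card F) :
    ∃ (V : AddSubgroup F) (e : F), Nat.card V = 4 ∧
      ∀ s ∈ V, s ≠ 0 → ∀ y : F, y ^ 2 + s * y ≠ e := by
  let _ : Algebra (ZMod 2) F := ZMod.algebra F 2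
  have h2 : (2 : F) = 0 := CharTwo.two_eq_zero
  obtain ⟨b, hb⟩ := exists_pow_four_ne hF
  have h0 : b ≠ 0 := by rintro rfl; simp at hb
  have h1 : b ≠ 1 := by rintro rfl; simp at hb
  obtain ⟨z, hz⟩ := exists_trace_mul_inv (a := 1) (b := b) one_ne_zero h0
    (fun h => h1 (CharTwo.add_eq_zero.1 h).symm)
    (fun h => hb (by linear_combination b * (b - 1) * h))
  refine ⟨fourGroup b, z ^ 2, card_fourGroup h0 h1, fun s hs hs0 y => ?_⟩
  refine sq_add_mul_ne_sq hs0 (hz s ?_) y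
  rcases mem_fourGroup.1 hs with rfl | rfl | rfl | rfl
  · exact absurd rfl hs0
  all_goals simp

/-! ### Quadrangles on two parabolas -/

/-- The point with first coordinate `x` on the parabola `Y = X ^ 2 + c`, in homogeneous
coordinates. -/
def parabolaPoint (c x : F) : Fin 3 → F := ![1, x, x ^ 2 + c]

/-- Noncollinearity of three points, two of which are on the same parabola: by `hd` the quotient of
the determinant of their coordinates by `x₁ + x₂` is not zero. -/
theorem eq_zero_of_parabolaPoint_dotProduct [CharP F 2] {c d x₁ x₂ x₃ : F} (h : x₁ ≠ x₂)
    (hd : (x₁ + x₃) ^ 2 + (x₁ + x₂) * (x₁ + x₃) ≠ c + d) {w : Fin 3 → F}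
    (h1 : parabolaPoint c x₁ ⬝ᵥ w = 0) (h2 : parabolaPoint c x₂ ⬝ᵥ w = 0)
    (h3 : parabolaPoint d x₃ ⬝ᵥ w = 0) : w = 0 := by
  have h2' : (2 : F) = 0 := CharTwo.two_eq_zero
  simp only [parabolaPoint, dotProduct, Fin.sum_univ_three, Matrix.cons_val] at h1 h2 h3
  have hs : x₁ - x₂ ≠ 0 := sub_ne_zero.2 h
  have e1 : w 1 = (x₁ + x₂) * w 2 := by
    refine mul_left_cancel₀ hs ?_
    linear_combination h1 - h2 - (x₁ ^ 2 - x₂ ^ 2) * w 2 * h2'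
  have e2 : ((x₁ + x₃) ^ 2 + (x₁ + x₂) * (x₁ + x₃) - (c + d)) * w 2 = 0 := by
    linear_combination h1 + h3 - (x₁ + x₃) * e1 + (-w 0 - c * w 2 - d * w 2 +
      x₁ * x₃ * w 2) * h2'
  have e3 : w 2 = 0 := (mul_eq_zero.1 e2).resolve_left (sub_ne_zero.2 hd)
  have e4 : w 1 = 0 := by rw [e1, e3, mul_zero]
  have e5 : w 0 = 0 := by simpa [e3, e4] using h1
  ext i
  fin_cases i <;> assumption

variable (V : AddSubgroup F) (e : F)

/-- The constant term of the parabola carrying a quadrangle: `0` for the quadrangle of a coset of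
`V`, and `e` for the additional quadrangle `none`. -/
def quadrangleConst : Option (F ⧸ V) → F
  | some _ => 0
  | none => e

/-- A representative of the coset of `V` of the first coordinates of the points of a quadrangle. -/
noncomputable def quadrangleRep : Option (F ⧸ V) → F
  | some g => g.out
  | none => 0

/-- The four points of the quadrangle `X.1`, indexed by the elements `X.2` of `V`: they are the
points of `Y = X ^ 2` over a coset of `V`, or the points of `Y = X ^ 2 + e` over `V` itself. -/
noncomputable def quadranglePoint (X : Option (F ⧸ V) × V) : Fin 3 → F :=
  parabolaPoint (quadrangleConst V e X.1) (quadrangleRep V X.1 + X.2)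

variable {V e}

theorem quadrangleRep_add_injective (g : Option (F ⧸ V)) :
    Function.Injective fun v : V => quadrangleRep V g + v :=
  fun _ _ h => Subtype.ext (add_left_cancel h)

theorem quadrangleRep_some_add_ne {g h : F ⧸ V} (hgh : g ≠ h) (u v : V) :
    quadrangleRep V (some g) + u ≠ quadrangleRep V (some h) + v := by
  intro huv
  have := congrArg (QuotientAddGroup.mk (s := V)) huv
  rw [QuotientAddGroup.mk_add_of_mem _ u.2, QuotientAddGroup.mk_add_of_mem _ v.2] at this
  simp only [quadrangleRep, QuotientAddGroup.out_eq'] at this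
  exact hgh this

/-- The points `(g, u)` and `(g, v)` of one quadrangle and a third point `(h, t)` are not
collinear. -/
theorem noncollinear_quadranglePoint [CharP F 2]
    (he : ∀ s ∈ V, s ≠ 0 → ∀ y : F, y ^ 2 + s * y ≠ e) {g h : Option (F ⧸ V)} {u v t : V}
    (huv : u ≠ v) (hut : (g, u) ≠ (h, t)) (hvt : (g, v) ≠ (h, t)) {w : Fin 3 → F}
    (h1 : quadranglePoint V e (g, u) ⬝ᵥ w = 0) (h2 : quadranglePoint V e (g, v) ⬝ᵥ w = 0)
    (h3 : quadranglePoint V e (h, t) ⬝ᵥ w = 0) : w = 0 := by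
  have h12 := (quadrangleRep_add_injective g).ne huv
  refine eq_zero_of_parabolaPoint_dotProduct h12 ?_ h1 h2 h3
  have hs : (quadrangleRep V g + u) + (quadrangleRep V g + v) = ((u + v : V) : F) := by
    rw [add_add_add_comm, CharTwo.add_self_eq_zero, zero_add, AddSubgroup.coe_add]
  have hs0 : ((u + v : V) : F) ≠ 0 := by rw [← hs]; exact fun h => h12 (CharTwo.add_eq_zero.1 h)
  dsimp only
  -- On a single parabola, the quotient in question is `(x₁ + x₃) * (x₂ + x₃)`.
  have key : ∀ x₁ x₂ x₃ c : F, x₁ ≠ x₃ → x₂ ≠ x₃ →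
      (x₁ + x₃) ^ 2 + (x₁ + x₂) * (x₁ + x₃) ≠ c + c := by
    intro x₁ x₂ x₃ c h13 h23 h
    rw [CharTwo.add_self_eq_zero] at h
    have h' : (x₁ + x₃) * (x₂ + x₃) = 0 := by
      linear_combination h - x₁ * (x₁ + x₃) * CharTwo.two_eq_zero (R := F)
    rcases mul_eq_zero.1 h' with h' | h'
    · exact h13 (CharTwo.add_eq_zero.1 h')
    · exact h23 (CharTwo.add_eq_zero.1 h')
  by_cases hgh : g = h
  · subst hgh
    exact key _ _ _ _ ((quadrangleRep_add_injective g).ne fun h => hut (by rw [h]))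
      ((quadrangleRep_add_injective g).ne fun h => hvt (by rw [h]))
  rcases g with _ | g <;> rcases h with _ | h
  · exact absurd rfl hgh
  · rw [hs]
    simpa [quadrangleConst] using he _ (u + v).2 hs0 _
  · rw [hs]
    simpa [quadrangleConst] using he _ (u + v).2 hs0 _
  · have hgh : g ≠ h := fun h => hgh (by rw [h])
    exact key _ _ _ _ (quadrangleRep_some_add_ne hgh _ _) (quadrangleRep_some_add_ne hgh _ _)

end

/-! ### The optimal code -/

theorem mainTheorem4 {F : Type*} [Field F] [Fintype F] [DecidableEq F] (m q n : ℕ)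
    (hm : 3 ≤ m) (hq : q = 2 ^ m) (hF : Fintype.card F = q) (hn : n = q + 4) :
    ∃ (C : LinearCode F n) (k : ℕ),
      C.IsSingletonOptimalLRC k 6 3 ∧ C.HasDisjointRepairGroups 3 := by
  classical
  have : CharP F 2 := by
    have : Fact (Nat.Prime 2) := ⟨Nat.prime_two⟩
    exact charP_of_card_eq_prime_pow (hF.trans hq)
  have hq4 : 4 < Fintype.card F := by
    rw [hF, hq]
    exact lt_of_lt_of_le (by norm_num) (Nat.pow_le_pow_right (by norm_num) hm)
  obtain ⟨V, e, hV, he⟩ := exists_addSubgroup_card_four_sq_add_mul_ne hq4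
  rw [Nat.card_eq_fintype_card] at hV
  -- There are `q / 4` cosets and one additional quadrangle, hence `q + 4` points.
  have hcard : Fintype.card F = Fintype.card (F ⧸ V) * 4 := by
    have := V.card_eq_card_quotient_mul_card_addSubgroup
    simpa only [Nat.card_eq_fintype_card, hV] using this
  have hn' : Fintype.card (Fin n) = Fintype.card (Option (F ⧸ V) × V) := by
    rw [Fintype.card_prod, Fintype.card_option, hV, Fintype.card_fin, hn, ← hF, hcard]
    ring
  let E := Fintype.equivOfCardEq hn'
  have hp : LinearCode.NoGroupSecantMeets (fun P => quadranglePoint V e (E P))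
      (fun P => (E P).1) := by
    intro P Q R hPQ hPR hQR hg w h1 h2 h3
    have hg : (E P).1 = (E Q).1 := hg
    dsimp only at h1 h2 h3
    have hPQ := E.injective.ne hPQ
    have hPR := E.injective.ne hPR
    have hQR := E.injective.ne hQR
    generalize E P = X at *
    generalize E Q = Y at *
    generalize E R = Z at *
    obtain ⟨g, u⟩ := X
    obtain ⟨g', v⟩ := Y
    obtain rfl : g = g' := hg
    exact noncollinear_quadranglePoint he (fun h => hPQ (by rw [h])) hPR hQR h1 h2 h3
  have hg : ∀ i, (LinearCode.fiber (fun P => (E P).1) i).card = 4 := by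
    intro i
    rw [← hV, ← Finset.card_univ]
    refine Finset.card_bij' (fun P _ => (E P).2) (fun v _ => E.symm (i, v)) ?_ ?_ ?_ ?_
    · simp
    · simp
    · intro P hP
      have hP : (E P).1 = i := by simpa using hP
      simp [← hP]
    · simp
  exact ⟨_, _, LinearCode.isSingletonOptimalLRC_groupCode hp hg,
    LinearCode.hasDisjointRepairGroups_groupCode hp hg⟩
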